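/- Let $M>0$ and let $\mathbb T_M=\mathbb R/M\mathbb Z$. Let $\mathcal S(\mathbb T_M)$ be the space of real smooth $M$-periodic functions with its Fréchet topology (uniform convergence of all derivatives), and $\mathcal S'(\mathbb T_M)$ its topological dual, the space of periodic distributions; functions are viewed as distributions through $\langle f,\varphi\rangle=\int_0^M f(t)\varphi(t)\,dt$. Let $\mathrm L=\mathrm D^{\alpha+1}$ with an integer $\alpha\ge 1$, and let $\mathrm L^\dagger$ be its pseudoinverse on $\mathcal S'(\mathbb T_M)$, which multiplies the $k$-th Fourier coefficient by $(2\pi i k/M)^{-(\alpha+1)}$ for $k\neq0$ and sets the $0$-th one to zero. For $w\in\mathcal S'(\mathbb T_M)$ and $\mathbf w=(w_1,w_2)\in\mathcal S'(\mathbb T_M)^2$ put $$\|w\|_{\rm TV}=\sup_{\|\varphi\|_\infty=1}\langle w,\varphi\rangle,\qquad \mathcal R(\mathbf w)=\sup_{\sup_t\|(\varphi_1(t),\varphi_2(t))\|_2=1}\big(\langle w_1,\varphi_1\rangle+\langle w_2,\varphi_2\rangle\big)\in[0,\infty],$$ with $\varphi,\varphi_1,\varphi_2\in\mathcal S(\mathbb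 T_M)$. Let $\mathcal M(\mathbb T_M)\subset\mathcal S'(\mathbb T_M)$ be the space of finite signed Radon measures on $\mathbb T_M$, $\mathcal M_0(\mathbb T_M)=\{w\in\mathcal M(\mathbb T_M):\langle w,1\rangle=0\}$ with the norm $\|\cdot\|_{\rm TV}$, and let $$\mathcal M_{\rm L}(\mathbb T_M)=\{f\in\mathcal S'(\mathbb T_M):\|\mathrm L f\|_{\rm TV}<\infty\},\qquad \mathcal X_{\rm L}(\mathbb T_M)=\{\mathbf r=(r_1,r_2)\in\mathcal S'(\mathbb T_M)^2:\mathcal R(\mathrm L r_1,\mathrm L r_2)<\infty\},$$ with the norms $\|f\|=\|\mathrm Lf\|_{\rm TV}+|\langle f,1\rangle|$ and $\|\mathbf r\|=\mathcal R(\mathrm L r_1,\mathrm L r_2)+\max_i|\langle r_i,1\rangle|$. Then $\mathcal X_{\rm L}(\mathbb T_M)=\mathcal M_{\rm L}(\mathbb T_M)\times\mathcal M_{\rm L}(\mathbb T_M)$, as subspaces of $\mathcal S'(\mathbb T_M)^2$ and with the same topology. Moreover, the mapping $$T_{\rm L}:\mathcal X_{\rm L}(\mathbb T_M)\to\mathcal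 M_0(\mathbb T_M)^2\times\mathbb R^2,\qquad T_{\rm L}(\mathbf r)=\big(\mathrm L r_1,\mathrm L r_2,\langle r_1,1\rangle,\langle r_2,1\rangle\big)$$ is well defined and is an isomorphism (a linear homeomorphism), whose inverse is $$T_{\rm L}^{-1}(\mathbf w,\mathbf a)=\Big(\mathrm L^\dagger w_1+\tfrac{a_1}{M},\ \mathrm L^\dagger w_2+\tfrac{a_2}{M}\Big).$$ -/

import Mathlib

open scoped ContDiff
open MeasureTheory

noncomputable section

namespace PeriodicCurve

/-! ### Periodic test functions -/

/-- The space `S(T_M)` of smooth `M`-periodic functions `ℝ → ℝ`. -/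
structure TestFun (M : ℝ) where
  toFun : ℝ → ℝ
  contDiff' : ContDiff ℝ ∞ toFun
  periodic' : Function.Periodic toFun M

namespace TestFun

variable {M : ℝ}

instance : FunLike (TestFun M) ℝ ℝ where
  coe := toFun
  coe_injective φ ψ h := by
    cases φ
    cases ψ
    congr

theorem contDiff (φ : TestFun M) : ContDiff ℝ ∞ φ := φ.contDiff'

theorem periodic (φ : TestFun M) : Function.Periodic φ M := φ.periodic'

theorem continuous (φ : TestFun M) : Continuous φ := φ.contDiff.continuous

@[ext] theorem ext {φ ψ : TestFun M} (h : ∀ t, φ t = ψ t) : φ = ψ := DFunLike.ext _ _ h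

instance : Zero (TestFun M) := ⟨⟨fun _ => 0, contDiff_const, fun _ => rfl⟩⟩

instance : Add (TestFun M) :=
  ⟨fun φ ψ => ⟨fun t => φ t + ψ t, φ.contDiff.add ψ.contDiff, φ.periodic.add ψ.periodic⟩⟩

instance : Neg (TestFun M) := ⟨fun φ => ⟨fun t => -φ t, φ.contDiff.neg, fun t => by
  simp only [φ.periodic t]⟩⟩

instance : Sub (TestFun M) :=
  ⟨fun φ ψ => ⟨fun t => φ t - ψ t, φ.contDiff.sub ψ.contDiff, φ.periodic.sub ψ.periodic⟩⟩

instance {R : Type*} [SMul R ℝ] [IsScalarTower R ℝ ℝ] : SMul R (TestFun M) :=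
  ⟨fun c φ => ⟨fun t => c • φ t, by
    have h : (fun t => c • φ t) = fun t => (c • (1 : ℝ)) * φ t := by
      funext t
      rw [smul_mul_assoc, one_mul]
    rw [h]
    exact contDiff_const.mul φ.contDiff, fun t => by simp only [φ.periodic t]⟩⟩

instance : AddCommGroup (TestFun M) :=
  DFunLike.coe_injective.addCommGroup (fun φ : TestFun M => (φ : ℝ → ℝ)) rfl (fun _ _ => rfl)
    (fun _ => rfl) (fun _ _ => rfl) (fun _ _ => rfl) (fun _ _ => rfl)

/-- Evaluation on `ℝ`, as an additive map. -/
def coeHom (M : ℝ) : TestFun M →+ (ℝ → ℝ) where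
  toFun φ := φ
  map_zero' := rfl
  map_add' _ _ := rfl

instance : Module ℝ (TestFun M) :=
  DFunLike.coe_injective.module ℝ (coeHom M) (fun _ _ => rfl)

@[simp] theorem add_apply (φ ψ : TestFun M) (t : ℝ) : (φ + ψ) t = φ t + ψ t := rfl

@[simp] theorem sub_apply (φ ψ : TestFun M) (t : ℝ) : (φ - ψ) t = φ t - ψ t := rfl

@[simp] theorem neg_apply (φ : TestFun M) (t : ℝ) : (-φ) t = -φ t := rfl

@[simp] theorem smul_apply (c : ℝ) (φ : TestFun M) (t : ℝ) : (c • φ) t = c * φ t := rfl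

@[simp] theorem zero_apply (t : ℝ) : (0 : TestFun M) t = 0 := rfl

theorem intervalIntegrable (φ : TestFun M) (a b : ℝ) :
    IntervalIntegrable φ volume a b := φ.continuous.intervalIntegrable a b

/-- The constant test function `1`. -/
def one (M : ℝ) : TestFun M := ⟨fun _ => 1, contDiff_const, fun _ => rfl⟩

@[simp] theorem one_apply (t : ℝ) : one M t = 1 := rfl

/-- The derivative `φ ↦ φ'` on test functions. -/
def derivLin (M : ℝ) : TestFun M →ₗ[ℝ] TestFun M where
  toFun φ := ⟨fun t => deriv φ t, (contDiff_infty_iff_deriv.1 φ.contDiff).2, fun t => by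
    have h : (fun s => φ (s + M)) = φ := funext φ.periodic
    change deriv φ (t + M) = deriv φ t
    rw [← deriv_comp_add_const, h]⟩
  map_add' φ ψ := by
    ext t
    exact deriv_add ((contDiff_infty_iff_deriv.1 φ.contDiff).1 t)
      ((contDiff_infty_iff_deriv.1 ψ.contDiff).1 t)
  map_smul' c φ := by
    ext t
    exact deriv_const_mul c ((contDiff_infty_iff_deriv.1 φ.contDiff).1 t)

/-- The integral over one period, `φ ↦ ∫₀ᴹ φ(t) dt`. -/
def integralLin (M : ℝ) : TestFun M →ₗ[ℝ] ℝ where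
  toFun φ := ∫ t in (0 : ℝ)..M, φ t
  map_add' φ ψ := intervalIntegral.integral_add (φ.intervalIntegrable _ _)
    (ψ.intervalIntegrable _ _)
  map_smul' c _ := intervalIntegral.integral_const_mul c _

/-- The mean-free part `φ - M⁻¹ ∫₀ᴹ φ` of a test function. -/
def meanFree (M : ℝ) : TestFun M →ₗ[ℝ] TestFun M :=
  LinearMap.id - (M⁻¹ • integralLin M).smulRight (one M)

theorem meanFree_apply (φ : TestFun M) : meanFree M φ = φ - (M⁻¹ * integralLin M φ) • one M := rfl

theorem integralLin_one : integralLin M (one M) = M := by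
  change ∫ t in (0 : ℝ)..M, (1 : ℝ) = M
  simp

theorem derivLin_one : derivLin M (one M) = 0 := by
  ext t
  exact deriv_const t (1 : ℝ)

variable [hM : Fact (0 < M)]

theorem bddAbove (φ : TestFun M) : BddAbove (Set.range fun t => |φ t|) := by
  obtain ⟨C, hC⟩ := (φ.periodic.isBounded_of_continuous hM.out.ne' φ.continuous).exists_norm_le
  exact ⟨C, by rintro _ ⟨t, rfl⟩; exact hC _ ⟨t, rfl⟩⟩

/-- The uniform norm `sup_t |φ(t)|` on test functions, as a seminorm. -/
def supSeminorm (M : ℝ) [Fact (0 < M)] : Seminorm ℝ (TestFun M) :=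
  Seminorm.ofSMulLE (fun φ => ⨆ t, |φ t|) (by simp)
    (fun φ ψ => ciSup_le fun t => (abs_add_le _ _).trans
      (add_le_add (le_ciSup φ.bddAbove t) (le_ciSup ψ.bddAbove t)))
    (fun c φ => ciSup_le fun t => by
      rw [smul_apply, abs_mul, Real.norm_eq_abs]
      exact mul_le_mul_of_nonneg_left (le_ciSup φ.bddAbove t) (abs_nonneg c))

theorem supSeminorm_apply (φ : TestFun M) : supSeminorm M φ = ⨆ t, |φ t| := rfl

theorem abs_le_supSeminorm (φ : TestFun M) (t : ℝ) : |φ t| ≤ supSeminorm M φ :=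
  le_ciSup φ.bddAbove t

/-- The seminorms `φ ↦ sup_t |φ⁽ᵏ⁾(t)|`, `k = 0, 1, 2, …`. -/
def seminorms (M : ℝ) [Fact (0 < M)] : SeminormFamily ℝ (TestFun M) ℕ :=
  fun k => (supSeminorm M).comp (derivLin M ^ k)

/-- The usual Fréchet topology of `S(T_M)`: uniform convergence of all derivatives. -/
instance : TopologicalSpace (TestFun M) := (seminorms M).moduleFilterBasis.topology

theorem withSeminorms (M : ℝ) [Fact (0 < M)] : WithSeminorms (seminorms M) := ⟨rfl⟩

instance : IsTopologicalAddGroup (TestFun M) := (withSeminorms M).topologicalAddGroup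

instance : ContinuousSMul ℝ (TestFun M) := (withSeminorms M).continuousSMul

theorem seminorms_zero (φ : TestFun M) : seminorms M 0 φ = supSeminorm M φ := rfl

theorem seminorms_succ (k : ℕ) (φ : TestFun M) :
    seminorms M (k + 1) φ = seminorms M k (derivLin M φ) := by
  simp only [seminorms, Seminorm.comp_apply, pow_succ]
  rfl

theorem abs_integralLin_le (φ : TestFun M) : |integralLin M φ| ≤ M * supSeminorm M φ := by
  have := intervalIntegral.norm_integral_le_of_norm_le_const (a := 0) (b := M)
    (f := φ) (C := supSeminorm M φ) (fun t _ => φ.abs_le_supSeminorm t)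
  rwa [sub_zero, abs_of_pos hM.out, mul_comm, Real.norm_eq_abs] at this

/-- `φ ↦ φ'` as a continuous linear map of `S(T_M)`. -/
def derivCLM (M : ℝ) [Fact (0 < M)] : TestFun M →L[ℝ] TestFun M where
  toLinearMap := derivLin M
  cont := WithSeminorms.continuous_of_isBounded (withSeminorms M) (withSeminorms M) _
    (Seminorm.IsBounded.of_real fun k => ⟨{k + 1}, 1, fun φ => by
      simp [seminorms_succ]⟩)

/-- `φ ↦ ∫₀ᴹ φ(t) dt` as a continuous linear functional on `S(T_M)`. -/
def integralCLM (M : ℝ) [Fact (0 < M)] : TestFun M →L[ℝ] ℝ where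
  toLinearMap := integralLin M
  cont := WithSeminorms.continuous_of_isBounded (withSeminorms M) (norm_withSeminorms ℝ ℝ) _
    (Seminorm.IsBounded.of_real fun _ => ⟨{0}, M, fun φ => by
      simpa [Seminorm.comp_apply, seminorms_zero] using abs_integralLin_le φ⟩)

theorem integralLin_meanFree (φ : TestFun M) : integralLin M (meanFree M φ) = 0 := by
  have h : M ≠ 0 := hM.out.ne'
  rw [meanFree_apply, map_sub, map_smul, integralLin_one, smul_eq_mul]
  field_simp
  ring

/-- The periodic primitive `t ↦ ∫₀ᵗ (φ - M⁻¹ ∫₀ᴹ φ)`, before normalization of its mean. -/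
def primitiveAux (M : ℝ) [hM : Fact (0 < M)] : TestFun M →ₗ[ℝ] TestFun M where
  toFun φ := ⟨fun t => ∫ s in (0 : ℝ)..t, meanFree M φ s,
    contDiff_infty_iff_deriv.2 ⟨fun t =>
        ((meanFree M φ).continuous.integral_hasStrictDerivAt 0 t).hasDerivAt.differentiableAt, by
      have : deriv (fun t => ∫ s in (0 : ℝ)..t, meanFree M φ s) = meanFree M φ :=
        funext fun t => (meanFree M φ).continuous.deriv_integral _ 0 t
      rw [this]
      exact (meanFree M φ).contDiff⟩, fun t => by
    have h1 := (meanFree M φ).periodic.intervalIntegral_add_eq t 0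
    have h2 : ∫ s in (0 : ℝ)..M, meanFree M φ s = 0 := integralLin_meanFree φ
    rw [zero_add, h2] at h1
    have h3 := intervalIntegral.integral_add_adjacent_intervals
      ((meanFree M φ).intervalIntegrable 0 t) ((meanFree M φ).intervalIntegrable t (t + M))
    change ∫ s in (0 : ℝ)..(t + M), meanFree M φ s = ∫ s in (0 : ℝ)..t, meanFree M φ s
    rw [← h3, h1, add_zero]⟩
  map_add' φ ψ := by
    ext t
    change ∫ s in (0 : ℝ)..t, meanFree M (φ + ψ) s = _
    rw [map_add]
    exact intervalIntegral.integral_add ((meanFree M φ).intervalIntegrable _ _)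
      ((meanFree M ψ).intervalIntegrable _ _)
  map_smul' c φ := by
    ext t
    change ∫ s in (0 : ℝ)..t, meanFree M (c • φ) s = _
    rw [map_smul]
    exact intervalIntegral.integral_const_mul c _

/-- The pseudoinverse of `φ ↦ φ'` on test functions: `φ` is mapped to the unique mean-free
periodic primitive of `φ - M⁻¹ ∫₀ᴹ φ`. In terms of Fourier coefficients, it multiplies the `k`-th
coefficient by `(2πik/M)⁻¹` for `k ≠ 0` and annihilates the `0`-th one. -/
def primitiveLin (M : ℝ) [Fact (0 < M)] : TestFun M →ₗ[ℝ] TestFun M :=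
  meanFree M ∘ₗ primitiveAux M

theorem derivLin_primitiveLin (φ : TestFun M) :
    derivLin M (primitiveLin M φ) = meanFree M φ := by
  rw [primitiveLin, LinearMap.comp_apply, meanFree_apply (primitiveAux M φ), map_sub, map_smul,
    derivLin_one, smul_zero, sub_zero]
  ext t
  exact (meanFree M φ).continuous.deriv_integral _ 0 t

theorem integralLin_primitiveLin (φ : TestFun M) : integralLin M (primitiveLin M φ) = 0 :=
  integralLin_meanFree _

theorem seminorms_meanFree_le (k : ℕ) (φ : TestFun M) :
    seminorms M k (meanFree M φ) ≤
      seminorms M k φ + seminorms M k (one M) * supSeminorm M φ := by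
  have h : |M⁻¹ * integralLin M φ| ≤ supSeminorm M φ := by
    rw [abs_mul, abs_of_pos (inv_pos.2 hM.out), inv_mul_le_iff₀ hM.out]
    exact abs_integralLin_le φ
  rw [meanFree_apply]
  refine (map_sub_le_add (seminorms M k) _ _).trans (add_le_add_right ?_ _)
  rw [map_smul_eq_mul, Real.norm_eq_abs, mul_comm]
  exact mul_le_mul_of_nonneg_left h (apply_nonneg _ _)

theorem supSeminorm_one : supSeminorm M (one M) = 1 := by
  simp [supSeminorm_apply]

theorem supSeminorm_meanFree_le (φ : TestFun M) :
    supSeminorm M (meanFree M φ) ≤ 2 * supSeminorm M φ := by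
  have := seminorms_meanFree_le 0 φ
  rw [seminorms_zero, seminorms_zero, seminorms_zero, supSeminorm_one] at this
  linarith

theorem supSeminorm_primitiveAux_le (φ : TestFun M) :
    supSeminorm M (primitiveAux M φ) ≤ M * (2 * supSeminorm M φ) := by
  refine ciSup_le fun t => ?_
  obtain ⟨s, hs, hst⟩ := (primitiveAux M φ).periodic.exists_mem_Ico₀ hM.out t
  rw [hst]
  have := intervalIntegral.norm_integral_le_of_norm_le_const (a := 0) (b := s)
    (f := meanFree M φ) (C := supSeminorm M (meanFree M φ))
    (fun t _ => (meanFree M φ).abs_le_supSeminorm t)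
  rw [sub_zero, abs_of_nonneg hs.1, Real.norm_eq_abs, mul_comm] at this
  exact this.trans (mul_le_mul hs.2.le (supSeminorm_meanFree_le φ) (apply_nonneg _ _) hM.out.le)

/-- `primitiveLin` as a continuous linear map of `S(T_M)`. -/
def primitiveCLM (M : ℝ) [Fact (0 < M)] : TestFun M →L[ℝ] TestFun M where
  toLinearMap := primitiveLin M
  cont := WithSeminorms.continuous_of_isBounded (withSeminorms M) (withSeminorms M) _
    (Seminorm.IsBounded.of_real fun k => by
      cases k with
      | zero =>
        refine ⟨{0}, 4 * M, fun φ => ?_⟩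
        simp only [Finset.sup_singleton]
        change supSeminorm M (primitiveLin M φ) ≤ (4 * M) * supSeminorm M φ
        have h1 : supSeminorm M (primitiveLin M φ) ≤ 2 * supSeminorm M (primitiveAux M φ) :=
          supSeminorm_meanFree_le _
        have h2 := supSeminorm_primitiveAux_le φ
        linarith
      | succ k =>
        refine ⟨{k, 0}, 1 + seminorms M k (one M), fun φ => ?_⟩
        have h0 : (seminorms M k φ) ≤ (({k, 0} : Finset ℕ).sup (seminorms M)) φ :=
          Seminorm.le_finset_sup_apply (by simp)
        have h1 : (seminorms M 0 φ) ≤ (({k, 0} : Finset ℕ).sup (seminorms M)) φ :=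
          Seminorm.le_finset_sup_apply (by simp)
        have h2 := seminorms_meanFree_le k φ
        have h3 := mul_le_mul_of_nonneg_left h1 (apply_nonneg (seminorms M k) (one M))
        rw [seminorms_zero] at h3
        change seminorms M (k + 1) (primitiveLin M φ) ≤
          (1 + seminorms M k (one M)) * (({k, 0} : Finset ℕ).sup (seminorms M)) φ
        rw [seminorms_succ, derivLin_primitiveLin]
        linarith)

end TestFun

variable (M : ℝ) [hM : Fact (0 < M)]

/-! ### Periodic distributions, the operators `L` and `L†` -/

/-- The space `S'(T_M)` of real periodic distributions: continuous linear functionals on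
`S(T_M)`, with `w φ = ⟨w, φ⟩`. -/
abbrev Distr : Type := TestFun M →L[ℝ] ℝ

/-- The distributional derivative, `⟨D w, φ⟩ = -⟨w, φ'⟩`. -/
def distrDeriv : Distr M →ₗ[ℝ] Distr M where
  toFun w := -(w.comp (TestFun.derivCLM M))
  map_add' w v := by
    ext φ
    change -(w _ + v _) = -w _ + -v _
    ring
  map_smul' c w := by
    ext φ
    change -(c * w _) = c * -w _
    ring

/-- The operator `L = D^(α+1)` on periodic distributions. -/
def opL (α : ℕ) : Distr M →ₗ[ℝ] Distr M := distrDeriv M ^ (α + 1)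

/-- The pseudoinverse `D†` of `D`, defined by duality. Like its counterpart on test functions, it
multiplies the `k`-th Fourier coefficient by `(2πik/M)⁻¹` for `k ≠ 0` and annihilates the `0`-th
one. -/
def distrPrimitive : Distr M →ₗ[ℝ] Distr M where
  toFun w := -(w.comp (TestFun.primitiveCLM M))
  map_add' w v := by
    ext φ
    change -(w _ + v _) = -w _ + -v _
    ring
  map_smul' c w := by
    ext φ
    change -(c * w _) = c * -w _
    ring

/-- The pseudoinverse `L†` of `L = D^(α+1)`: the Fourier multiplier that multiplies the `k`-th
Fourier coefficient by `(2πik/M)^(-(α+1))` for `k ≠ 0` and annihilates the `0`-th one. -/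
def opLDagger (α : ℕ) : Distr M →ₗ[ℝ] Distr M := distrPrimitive M ^ (α + 1)

/-- The constant function `a`, as the distribution `φ ↦ ∫₀ᴹ a φ(t) dt`. -/
def constDistr (a : ℝ) : Distr M := a • TestFun.integralCLM M

/-- The pairing `w ↦ ⟨w, φ⟩` with a fixed test function. -/
def pairing (φ : TestFun M) : Distr M →ₗ[ℝ] ℝ where
  toFun w := w φ
  map_add' _ _ := rfl
  map_smul' _ _ := rfl

/-! ### The TV norm and the RI-TV norm -/

/-- The mixed norm `sup_t ‖φ(t)‖₂` of a smooth periodic curve `φ = (φ₁, φ₂)`. -/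
def mixedNorm (φ : TestFun M × TestFun M) : ℝ := ⨆ t : ℝ, ‖!₂[φ.1 t, φ.2 t]‖

/-- The total-variation norm of a periodic distribution,
`‖w‖_TV = sup {⟨w, φ⟩ : ‖φ‖_∞ = 1} ∈ [0, ∞]`. -/
def tvNorm (w : Distr M) : EReal :=
  ⨆ (φ : TestFun M) (_ : TestFun.supSeminorm M φ = 1), ((w φ : ℝ) : EReal)

/-- The RI-TV norm, i.e. the (TV-ℓ₂) norm, of a pair of periodic distributions,
`R(w) = sup {⟨w₁, φ₁⟩ + ⟨w₂, φ₂⟩ : ‖φ‖_{2,∞} = 1} ∈ [0, ∞]`. -/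
def ritvNorm (w : Distr M × Distr M) : EReal :=
  ⨆ (φ : TestFun M × TestFun M) (_ : mixedNorm M φ = 1),
    ((w.1 φ.1 + w.2 φ.2 : ℝ) : EReal)

section SupFunctional

/-! The set where a supremum of linear functionals over a symmetric set is finite is a subspace,
and the supremum is a seminorm there. -/

variable {E F : Type*} [AddCommGroup E] [Module ℝ E] [AddCommGroup F] [Module ℝ F]

/-- `sup {B x y : y ∈ S}`. -/
def supOn (B : E →ₗ[ℝ] F →ₗ[ℝ] ℝ) (S : Set F) (x : E) : EReal :=
  ⨆ (y : F) (_ : y ∈ S), ((B x y : ℝ) : EReal)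

variable {B : E →ₗ[ℝ] F →ₗ[ℝ] ℝ} {S : Set F}

theorem supOn_le_iff {x : E} {r : ℝ} : supOn B S x ≤ r ↔ ∀ y ∈ S, B x y ≤ r := by
  simp [supOn, iSup_le_iff, EReal.coe_le_coe_iff]

theorem le_supOn (x : E) {y : F} (hy : y ∈ S) : ((B x y : ℝ) : EReal) ≤ supOn B S x :=
  le_iSup₂_of_le y hy le_rfl

theorem supOn_nonneg (hS : S.Nonempty) (hneg : ∀ y ∈ S, -y ∈ S) (x : E) : 0 ≤ supOn B S x := by
  obtain ⟨y, hy⟩ := hS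
  rcases le_total 0 (B x y) with h | h
  · exact le_trans (EReal.coe_nonneg.2 h) (le_supOn x hy)
  · refine le_trans (EReal.coe_nonneg.2 ?_) (le_supOn x (hneg y hy))
    rw [map_neg]
    linarith

theorem coe_toReal_supOn (hS : S.Nonempty) (hneg : ∀ y ∈ S, -y ∈ S) {x : E}
    (hx : supOn B S x < ⊤) : (((supOn B S x).toReal : ℝ) : EReal) = supOn B S x :=
  EReal.coe_toReal hx.ne (ne_of_gt (lt_of_lt_of_le EReal.bot_lt_zero (supOn_nonneg hS hneg x)))

theorem le_toReal_supOn (hS : S.Nonempty) (hneg : ∀ y ∈ S, -y ∈ S) {x : E}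
    (hx : supOn B S x < ⊤) {y : F} (hy : y ∈ S) : B x y ≤ (supOn B S x).toReal := by
  rw [← EReal.coe_le_coe_iff, coe_toReal_supOn hS hneg hx]
  exact le_supOn x hy

theorem toReal_supOn_le (hS : S.Nonempty) (hneg : ∀ y ∈ S, -y ∈ S) {x : E} {r : ℝ}
    (h : ∀ y ∈ S, B x y ≤ r) : (supOn B S x).toReal ≤ r := by
  have h1 : supOn B S x ≤ r := supOn_le_iff.2 h
  rw [← EReal.coe_le_coe_iff, coe_toReal_supOn hS hneg (lt_of_le_of_lt h1 (EReal.coe_lt_top r))]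
  exact h1

theorem supOn_add_bound (hS : S.Nonempty) (hneg : ∀ y ∈ S, -y ∈ S) {x x' : E}
    (hx : supOn B S x < ⊤) (hx' : supOn B S x' < ⊤) :
    ∀ y ∈ S, B (x + x') y ≤ (supOn B S x).toReal + (supOn B S x').toReal := fun y hy => by
  rw [map_add, LinearMap.add_apply]
  exact add_le_add (le_toReal_supOn hS hneg hx hy) (le_toReal_supOn hS hneg hx' hy)

theorem supOn_smul_bound (hS : S.Nonempty) (hneg : ∀ y ∈ S, -y ∈ S) {x : E}
    (hx : supOn B S x < ⊤) (c : ℝ) :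
    ∀ y ∈ S, B (c • x) y ≤ |c| * (supOn B S x).toReal := fun y hy => by
  have h1 := le_toReal_supOn hS hneg hx hy
  have h2 := le_toReal_supOn hS hneg hx (hneg y hy)
  rw [map_neg] at h2
  rw [map_smul, LinearMap.smul_apply, smul_eq_mul]
  calc c * B x y ≤ |c * B x y| := le_abs_self _
    _ = |c| * |B x y| := abs_mul _ _
    _ ≤ _ := mul_le_mul_of_nonneg_left (abs_le.2 ⟨by linarith, h1⟩) (abs_nonneg c)

/-- The subspace `{x : sup {B x y : y ∈ S} < ∞}`. -/
def finiteSubmodule (B : E →ₗ[ℝ] F →ₗ[ℝ] ℝ) (S : Set F) (hS : S.Nonempty)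
    (hneg : ∀ y ∈ S, -y ∈ S) : Submodule ℝ E where
  carrier := {x | supOn B S x < ⊤}
  add_mem' hx hx' :=
    lt_of_le_of_lt (supOn_le_iff.2 (supOn_add_bound hS hneg hx hx')) (EReal.coe_lt_top _)
  zero_mem' :=
    lt_of_le_of_lt (supOn_le_iff (r := 0).2 fun y _ => by simp) (EReal.coe_lt_top _)
  smul_mem' c _ hx :=
    lt_of_le_of_lt (supOn_le_iff.2 (supOn_smul_bound hS hneg hx c)) (EReal.coe_lt_top _)

/-- The seminorm `x ↦ sup {B x y : y ∈ S}` on the subspace where it is finite. -/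
def finiteSeminorm (B : E →ₗ[ℝ] F →ₗ[ℝ] ℝ) (S : Set F) (hS : S.Nonempty)
    (hneg : ∀ y ∈ S, -y ∈ S) : Seminorm ℝ (finiteSubmodule B S hS hneg) :=
  Seminorm.ofSMulLE (fun x => (supOn B S (x : E)).toReal)
    (le_antisymm (toReal_supOn_le hS hneg fun y _ => by simp)
      (EReal.toReal_nonneg (supOn_nonneg hS hneg _)))
    (fun x x' => toReal_supOn_le hS hneg (supOn_add_bound hS hneg x.2 x'.2))
    (fun c x => toReal_supOn_le hS hneg (supOn_smul_bound hS hneg x.2 c))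

end SupFunctional

/-- The duality pairing on `S'(T_M) × S(T_M)`. -/
def pairingB : Distr M →ₗ[ℝ] TestFun M →ₗ[ℝ] ℝ where
  toFun w := w.toLinearMap
  map_add' _ _ := rfl
  map_smul' _ _ := rfl

/-- The duality pairing on `S'(T_M)² × S(T_M)²`. -/
def pairingB₂ : (Distr M × Distr M) →ₗ[ℝ] (TestFun M × TestFun M) →ₗ[ℝ] ℝ where
  toFun w := w.1.toLinearMap.coprod w.2.toLinearMap
  map_add' w v := by
    ext φ <;> simp
  map_smul' c w := by
    ext φ <;> simp

theorem tvNorm_eq_supOn (w : Distr M) :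
    tvNorm M w = supOn (pairingB M) {φ | TestFun.supSeminorm M φ = 1} w := rfl

theorem ritvNorm_eq_supOn (w : Distr M × Distr M) :
    ritvNorm M w = supOn (pairingB₂ M) {φ | mixedNorm M φ = 1} w := rfl

theorem unitSphere_nonempty : {φ | TestFun.supSeminorm M φ = 1}.Nonempty :=
  ⟨TestFun.one M, TestFun.supSeminorm_one⟩

theorem unitSphere_neg :
    ∀ φ ∈ {φ | TestFun.supSeminorm M φ = 1}, -φ ∈ {φ | TestFun.supSeminorm M φ = 1} :=
  fun φ hφ => by
    change TestFun.supSeminorm M (-φ) = 1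
    rw [map_neg_eq_map]
    exact hφ

theorem mixedSphere_nonempty : {φ | mixedNorm M φ = 1}.Nonempty :=
  ⟨(TestFun.one M, 0), by simp [mixedNorm, EuclideanSpace.norm_eq]⟩

theorem mixedSphere_neg : ∀ φ ∈ {φ | mixedNorm M φ = 1}, -φ ∈ {φ | mixedNorm M φ = 1} :=
  fun φ hφ => by
    have h : mixedNorm M (-φ) = mixedNorm M φ := by
      simp [mixedNorm, EuclideanSpace.norm_eq]
    exact h.trans hφ

/-- The subspace of periodic distributions of finite TV norm. -/
def finiteTV : Submodule ℝ (Distr M) :=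
  (finiteSubmodule (pairingB M) _ (unitSphere_nonempty M) (unitSphere_neg M)).copy
    {w | tvNorm M w < ⊤} rfl

/-- The subspace of pairs of periodic distributions of finite RI-TV norm. -/
def finiteRITV : Submodule ℝ (Distr M × Distr M) :=
  (finiteSubmodule (pairingB₂ M) _ (mixedSphere_nonempty M) (mixedSphere_neg M)).copy
    {w | ritvNorm M w < ⊤} rfl

/-- `w ↦ ‖w‖_TV` as a seminorm on the distributions of finite TV norm. -/
def tvSeminorm : Seminorm ℝ (finiteTV M) :=
  finiteSeminorm (pairingB M) _ (unitSphere_nonempty M) (unitSphere_neg M)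

/-- `w ↦ R(w)` as a seminorm on the pairs of distributions of finite RI-TV norm. -/
def ritvSeminorm : Seminorm ℝ (finiteRITV M) :=
  finiteSeminorm (pairingB₂ M) _ (mixedSphere_nonempty M) (mixedSphere_neg M)

theorem tvSeminorm_apply (w : finiteTV M) : tvSeminorm M w = (tvNorm M w).toReal := rfl

theorem ritvSeminorm_apply (w : finiteRITV M) : ritvSeminorm M w = (ritvNorm M w).toReal := rfl

/-! ### Periodic Radon measures -/

/-- `w` is given by a periodic finite Radon measure, i.e. by a finite signed Borel measure on the
circle `ℝ/Mℤ`, written as a difference `μ - ν` of finite positive Borel measures. -/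
def IsRadon (w : Distr M) : Prop :=
  ∃ μ ν : Measure (AddCircle M), IsFiniteMeasure μ ∧ IsFiniteMeasure ν ∧
    ∀ φ : TestFun M, w φ = (∫ x, φ.periodic.lift x ∂μ) - ∫ x, φ.periodic.lift x ∂ν

variable {M} in
theorem TestFun.continuous_lift (φ : TestFun M) : Continuous φ.periodic.lift :=
  continuous_coinduced_dom.2 φ.continuous

variable {M} in
theorem TestFun.integrable_lift (φ : TestFun M) (μ : Measure (AddCircle M)) [IsFiniteMeasure μ] :
    Integrable φ.periodic.lift μ :=
  φ.continuous_lift.integrable_of_hasCompactSupport (HasCompactSupport.of_compactSpace _)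

/-- The space `M(T_M)` of periodic finite Radon measures, as a subspace of `S'(T_M)`. -/
def radonMeasures : Submodule ℝ (Distr M) where
  carrier := {w | IsRadon M w}
  add_mem' := by
    rintro w w' ⟨μ, ν, hμ, hν, h⟩ ⟨μ', ν', hμ', hν', h'⟩
    refine ⟨μ + μ', ν + ν', inferInstance, inferInstance, fun φ => ?_⟩
    rw [integral_add_measure (φ.integrable_lift _) (φ.integrable_lift _),
      integral_add_measure (φ.integrable_lift _) (φ.integrable_lift _)]
    change w φ + w' φ = _
    rw [h, h']
    ring
  zero_mem' := ⟨0, 0, inferInstance, inferInstance, fun φ => by simp⟩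
  smul_mem' := by
    rintro c w ⟨μ, ν, hμ, hν, h⟩
    rcases le_total 0 c with hc | hc
    · refine ⟨c.toNNReal • μ, c.toNNReal • ν, inferInstance, inferInstance, fun φ => ?_⟩
      rw [integral_smul_nnreal_measure, integral_smul_nnreal_measure]
      change c * w φ = _
      rw [h, NNReal.smul_def, NNReal.smul_def, Real.coe_toNNReal c hc, smul_eq_mul, smul_eq_mul]
      ring
    · refine ⟨(-c).toNNReal • ν, (-c).toNNReal • μ, inferInstance, inferInstance, fun φ => ?_⟩
      rw [integral_smul_nnreal_measure, integral_smul_nnreal_measure]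
      change c * w φ = _
      rw [h, NNReal.smul_def, NNReal.smul_def, Real.coe_toNNReal (-c) (by linarith),
        smul_eq_mul, smul_eq_mul]
      ring

/-- The space `M₀(T_M)` of periodic Radon measures of zero mean, `⟨w, 1⟩ = 0`. -/
def radonMeasures₀ : Submodule ℝ (Distr M) :=
  radonMeasures M ⊓ LinearMap.ker (pairing M (TestFun.one M))

theorem radonMeasures₀_le_finiteTV : radonMeasures₀ M ≤ finiteTV M := by
  rintro w ⟨⟨μ, ν, hμ, hν, h⟩, -⟩
  have key : ∀ φ ∈ {φ | TestFun.supSeminorm M φ = 1},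
      pairingB M w φ ≤ μ.real Set.univ + ν.real Set.univ := fun φ hφ => by
    have hb : ∀ x, ‖φ.periodic.lift x‖ ≤ 1 := fun x => by
      obtain ⟨t, rfl⟩ := QuotientAddGroup.mk_surjective x
      have := φ.abs_le_supSeminorm t
      rw [show TestFun.supSeminorm M φ = 1 from hφ] at this
      exact this
    have h1 := norm_integral_le_of_norm_le_const (μ := μ) (Filter.Eventually.of_forall hb)
    have h2 := norm_integral_le_of_norm_le_const (μ := ν) (Filter.Eventually.of_forall hb)
    rw [Real.norm_eq_abs, one_mul] at h1 h2
    change w φ ≤ _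
    rw [h]
    linarith [(abs_le.1 h1).2, (abs_le.1 h2).1]
  exact lt_of_le_of_lt (supOn_le_iff.2 key) (EReal.coe_lt_top _)

theorem le_toReal_tvNorm {w : Distr M} (hw : tvNorm M w < ⊤) {φ : TestFun M}
    (hφ : TestFun.supSeminorm M φ = 1) : w φ ≤ (tvNorm M w).toReal :=
  le_toReal_supOn (B := pairingB M) (x := w) (y := φ) (unitSphere_nonempty M) (unitSphere_neg M)
    hw hφ

theorem eq_zero_of_tvSeminorm_eq_zero (w : finiteTV M) (h : tvSeminorm M w = 0) : w = 0 := by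
  have key : ∀ φ : TestFun M, (w : Distr M) φ ≤ 0 := fun φ => by
    by_cases h0 : TestFun.supSeminorm M φ = 0
    · have : φ = 0 := TestFun.ext fun t => by
        have := φ.abs_le_supSeminorm t
        rw [h0] at this
        simpa using this
      rw [this, map_zero]
    · have hpos : 0 < TestFun.supSeminorm M φ := lt_of_le_of_ne (apply_nonneg _ _) (Ne.symm h0)
      have h1 : TestFun.supSeminorm M ((TestFun.supSeminorm M φ)⁻¹ • φ) = 1 := by
        rw [map_smul_eq_mul, Real.norm_eq_abs, abs_of_pos (inv_pos.2 hpos), inv_mul_cancel₀ h0]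
      have h3 := le_toReal_tvNorm M w.2 h1
      rw [← tvSeminorm_apply, h, map_smul, smul_eq_mul] at h3
      by_contra! hc
      exact absurd h3 (not_le.2 (mul_pos (inv_pos.2 hpos) hc))
  ext φ
  refine le_antisymm (key φ) ?_
  have := key (-φ)
  rw [map_neg] at this
  change 0 ≤ _
  linarith

/-- The normed space `M₀(T_M)` (a type synonym, so that it carries no topology but that of the TV
norm). -/
def MeanZeroMeasure : Type := ↥(radonMeasures₀ M)

namespace MeanZeroMeasure

instance : AddCommGroup (MeanZeroMeasure M) := inferInstanceAs (AddCommGroup ↥(radonMeasures₀ M))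

instance : Module ℝ (MeanZeroMeasure M) := inferInstanceAs (Module ℝ ↥(radonMeasures₀ M))

/-- The inclusion `M₀(T_M) ⊆ S'(T_M)`. -/
def toDistr : MeanZeroMeasure M →ₗ[ℝ] Distr M := (radonMeasures₀ M).subtype

/-- The TV norm on `M₀(T_M)`. -/
def seminorm : Seminorm ℝ (MeanZeroMeasure M) :=
  (tvSeminorm M).comp (Submodule.inclusion (radonMeasures₀_le_finiteTV M))

instance : NormedAddCommGroup (MeanZeroMeasure M) :=
  AddGroupNorm.toNormedAddCommGroup
    { (seminorm M).toAddGroupSeminorm with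
      eq_zero_of_map_eq_zero' := fun _ hw => Submodule.inclusion_injective
        (radonMeasures₀_le_finiteTV M) (eq_zero_of_tvSeminorm_eq_zero M _ hw) }

instance : NormedSpace ℝ (MeanZeroMeasure M) where
  norm_smul_le c w := le_of_eq (map_smul_eq_mul (seminorm M) c w)

theorem norm_def (w : MeanZeroMeasure M) : ‖w‖ = (tvNorm M (toDistr M w)).toReal := rfl

end MeanZeroMeasure

/-! ### The native space and the search space -/

/-- The native space `M_L(T_M) = {f ∈ S'(T_M) : ‖L f‖_TV < ∞}`. -/
def nativeSpace (α : ℕ) : Submodule ℝ (Distr M) :=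
  ((finiteTV M).comap (opL M α)).copy {f | tvNorm M (opL M α f) < ⊤} rfl

/-- The search space `X_L(T_M) = {r ∈ S'(T_M)² : R(L r) < ∞}`, where `L r = (L r₁, L r₂)`. -/
def searchSpace (α : ℕ) : Submodule ℝ (Distr M × Distr M) :=
  ((finiteRITV M).comap ((opL M α).prodMap (opL M α))).copy
    {r | ritvNorm M (opL M α r.1, opL M α r.2) < ⊤} rfl

/-- `M_L(T_M)` as a (semi)normed space, `‖f‖ = ‖L f‖_TV + |⟨f, 1⟩|` (a type synonym, so that it
carries no other topology). -/
def NativeSpace (α : ℕ) : Type := ↥(nativeSpace M α)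

namespace NativeSpace

variable (α : ℕ)

instance : AddCommGroup (NativeSpace M α) := inferInstanceAs (AddCommGroup ↥(nativeSpace M α))

instance : Module ℝ (NativeSpace M α) := inferInstanceAs (Module ℝ ↥(nativeSpace M α))

/-- The inclusion `M_L(T_M) ⊆ S'(T_M)`. -/
def toDistr : NativeSpace M α →ₗ[ℝ] Distr M := (nativeSpace M α).subtype

/-- `f ↦ ‖L f‖_TV + |⟨f, 1⟩|`. -/
def seminorm : Seminorm ℝ (NativeSpace M α) :=
  (tvSeminorm M).comp ((opL M α).restrict (p := nativeSpace M α) (q := finiteTV M) fun _ h => h) +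
    (normSeminorm ℝ ℝ).comp (pairing M (TestFun.one M) ∘ₗ toDistr M α)

instance : SeminormedAddCommGroup (NativeSpace M α) :=
  AddGroupSeminorm.toSeminormedAddCommGroup (seminorm M α).toAddGroupSeminorm

instance : NormedSpace ℝ (NativeSpace M α) where
  norm_smul_le c w := le_of_eq (map_smul_eq_mul (seminorm M α) c w)

theorem norm_def (f : NativeSpace M α) :
    ‖f‖ = (tvNorm M (opL M α (toDistr M α f))).toReal + |toDistr M α f (TestFun.one M)| := rfl

end NativeSpace

/-- `X_L(T_M)` as a (semi)normed space, `‖r‖ = R(L r) + ‖(⟨r₁, 1⟩, ⟨r₂, 1⟩)‖_∞` (a type synonym, so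
that it carries no other topology). -/
def SearchSpace (α : ℕ) : Type := ↥(searchSpace M α)

namespace SearchSpace

variable (α : ℕ)

instance : AddCommGroup (SearchSpace M α) := inferInstanceAs (AddCommGroup ↥(searchSpace M α))

instance : Module ℝ (SearchSpace M α) := inferInstanceAs (Module ℝ ↥(searchSpace M α))

/-- The inclusion `X_L(T_M) ⊆ S'(T_M)²`. -/
def toDistr : SearchSpace M α →ₗ[ℝ] Distr M × Distr M := (searchSpace M α).subtype

/-- `r ↦ R(L r) + ‖(⟨r₁, 1⟩, ⟨r₂, 1⟩)‖_∞`. -/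
def seminorm : Seminorm ℝ (SearchSpace M α) :=
  (ritvSeminorm M).comp (((opL M α).prodMap (opL M α)).restrict (p := searchSpace M α)
      (q := finiteRITV M) fun _ h => h) +
    (normSeminorm ℝ (ℝ × ℝ)).comp
      ((pairing M (TestFun.one M)).prodMap (pairing M (TestFun.one M)) ∘ₗ toDistr M α)

instance : SeminormedAddCommGroup (SearchSpace M α) :=
  AddGroupSeminorm.toSeminormedAddCommGroup (seminorm M α).toAddGroupSeminorm

instance : NormedSpace ℝ (SearchSpace M α) where
  norm_smul_le c w := le_of_eq (map_smul_eq_mul (seminorm M α) c w)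

theorem norm_def (r : SearchSpace M α) :
    ‖r‖ = (ritvNorm M (opL M α (toDistr M α r).1, opL M α (toDistr M α r).2)).toReal +
      ‖((toDistr M α r).1 (TestFun.one M), (toDistr M α r).2 (TestFun.one M))‖ := rfl

end SearchSpace

end PeriodicCurve

end

open PeriodicCurve

/-! Two independent facts carry the theorem.

The first is analytic: a periodic distribution `w` with finite TV norm is a Radon measure
(`isRadon_of_tvNorm_lt_top`). By homogeneity `w` is bounded by a multiple of the uniform norm on
test functions, so Hahn–Banach and Riesz apply on the compact circle. One dominated extension to
`C(X) × C(X)`, under the sublinear functional `C * ‖f⁺ + g⁺‖`, yields both positive functionals at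
once; neither density of smooth functions nor a Jordan decomposition is needed.

The second is algebraic: `D` and its pseudoinverse commute, and their product is the projection
removing the mean. This projection is idempotent, so the product of `L` and `L†` is the same
projection in either order. Constants are killed by `L`, and both `L w` and `L† w` have mean zero,
so `f ↦ (L f, ⟨f, 1⟩)` and `(w, a) ↦ L† w + a / M` are mutually inverse between `M_L` and `M₀ × ℝ`.
The norm of `M_L` is the sum of the norms of the two components, hence this bijection is a
homeomorphism.

For pairs, `max (‖w₁‖, ‖w₂‖) ≤ R(w₁, w₂) ≤ ‖w₁‖ + ‖w₂‖` in TV norms. This identifies `X_L` with `M_L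
× M_L` both as a set and topologically, and `T_L` is then two copies of the scalar isomorphism with
the factors permuted. -/

noncomputable section

/-! ### Bounded functionals on continuous functions as differences of measures -/

namespace ContinuousMap

variable {X : Type*} [TopologicalSpace X] [CompactSpace X]

/-- The sublinear functional `(f, g) ↦ ‖f⁺ + g⁺‖` is subadditive. -/
theorem norm_sup_zero_add_sup_zero_le (f g f' g' : C(X, ℝ)) :
    ‖(f + f') ⊔ 0 + (g + g') ⊔ 0‖ ≤ ‖f ⊔ 0 + g ⊔ 0‖ + ‖f' ⊔ 0 + g' ⊔ 0‖ := by
  refine (norm_le _ (by positivity)).2 fun x => ?_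
  have h := (f ⊔ 0 + g ⊔ 0).norm_coe_le_norm x
  have h' := (f' ⊔ 0 + g' ⊔ 0).norm_coe_le_norm x
  simp only [add_apply, sup_apply, zero_apply, Real.norm_eq_abs] at h h' ⊢
  rw [abs_of_nonneg (by positivity)] at h h' ⊢
  grind

/-- Since `f⁺ + f⁻ = |f|`, the sublinear functional restricts to the uniform norm on the
antidiagonal `(f, -f)`, where the functional to be extended lives. -/
theorem norm_sup_zero_add_neg_sup_zero (f : C(X, ℝ)) : ‖f ⊔ 0 + (-f) ⊔ 0‖ = ‖f‖ := by
  have h : f ⊔ 0 + (-f) ⊔ 0 = |f| := posPart_add_negPart f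
  rw [h]
  refine le_antisymm ((norm_le _ (norm_nonneg _)).2 fun x => ?_)
    ((norm_le _ (norm_nonneg _)).2 fun x => ?_)
  · simpa using f.norm_coe_le_norm x
  · simpa using (|f|).norm_coe_le_norm x

variable [T2Space X] [MeasurableSpace X] [BorelSpace X]

/-- The Riesz representation theorem for positive functionals on `C(X, ℝ)`, `X` compact. -/
theorem exists_measure_of_nonneg (P : C(X, ℝ) →ₗ[ℝ] ℝ) (hP : ∀ f, 0 ≤ f → 0 ≤ P f) :
    ∃ μ : Measure X, IsFiniteMeasure μ ∧ ∀ f : C(X, ℝ), P f = ∫ x, f x ∂μ := by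
  let Λ : CompactlySupportedContinuousMap X ℝ →ₚ[ℝ] ℝ :=
    PositiveLinearMap.mk₀
      { toFun := fun g => P g.toContinuousMap
        map_add' := fun g g' => map_add P _ _
        map_smul' := fun c g => map_smul P c _ } fun g hg => hP _ hg
  refine ⟨RealRMK.rieszMeasure Λ, inferInstance, fun f => ?_⟩
  exact (RealRMK.integral_rieszMeasure Λ ⟨f, HasCompactSupport.of_compactSpace _⟩).symm

/-- A linear functional on a space of continuous functions that is bounded for the uniform norm is
represented by a difference of two finite measures. -/
theorem exists_measure_sub_measure_of_bound {V : Type*} [AddCommGroup V] [Module ℝ V]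
    (j : V →ₗ[ℝ] C(X, ℝ)) (hj : Function.Injective j) (F : V →ₗ[ℝ] ℝ) {C : ℝ} (hC : 0 ≤ C)
    (hF : ∀ v, F v ≤ C * ‖j v‖) :
    ∃ μ ν : Measure X, IsFiniteMeasure μ ∧ IsFiniteMeasure ν ∧
      ∀ v, F v = (∫ x, j v x ∂μ) - ∫ x, j v x ∂ν := by
  -- `V` is placed on the antidiagonal, so that an extension `G` splits `F v` as `G (j v, 0) - G (0,
  -- j v)`.
  let d : V →ₗ[ℝ] C(X, ℝ) × C(X, ℝ) := j.prod (-j)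
  have hd : Function.Injective d := fun v v' h => hj (congrArg Prod.fst h)
  obtain ⟨G, hG, hGN⟩ := exists_extension_of_le_sublinear
    ⟨LinearMap.range d, F ∘ₗ (LinearEquiv.ofInjective d hd).symm.toLinearMap⟩
    (fun p => C * ‖p.1 ⊔ 0 + p.2 ⊔ 0‖)
    (fun c hc p => by
      have h : ∀ f : C(X, ℝ), (c • f) ⊔ 0 = c • (f ⊔ 0) := fun f => by
        ext x
        simp [mul_max_of_nonneg _ _ hc.le]
      simp only [Prod.smul_fst, Prod.smul_snd]
      rw [h, h, ← smul_add, norm_smul, Real.norm_of_nonneg hc.le]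
      ring)
    (fun p q => by
      rw [← mul_add]
      exact mul_le_mul_of_nonneg_left (norm_sup_zero_add_sup_zero_le _ _ _ _) hC)
    (by
      rintro ⟨_, v, rfl⟩
      change F ((LinearEquiv.ofInjective d hd).symm (LinearEquiv.ofInjective d hd v)) ≤
        C * ‖j v ⊔ 0 + (-j v) ⊔ 0‖
      rw [LinearEquiv.symm_apply_apply, norm_sup_zero_add_neg_sup_zero]
      exact hF v)
  have hGF : ∀ v, G (d v) = F v := fun v => by
    refine (hG ⟨d v, v, rfl⟩).trans ?_
    change F ((LinearEquiv.ofInjective d hd).symm (LinearEquiv.ofInjective d hd v)) = F v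
    rw [LinearEquiv.symm_apply_apply]
  -- The dominating functional vanishes at `(-f, -g)` when `f, g ≥ 0`, so `G (-(f, g)) ≤ 0`:
  -- domination alone forces positivity.
  have hpos : ∀ f g : C(X, ℝ), 0 ≤ f → 0 ≤ g → 0 ≤ G (f, g) := fun f g hf hg => by
    have h := hGN (-(f, g))
    simp only [Prod.neg_mk, sup_of_le_right (neg_nonpos.2 hf), sup_of_le_right (neg_nonpos.2 hg),
      add_zero, norm_zero, mul_zero] at h
    rw [← Prod.neg_mk, map_neg] at h
    linarith
  obtain ⟨μ, hμ, hPμ⟩ := exists_measure_of_nonneg (G ∘ₗ LinearMap.inl ℝ _ _)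
    fun f hf => hpos f 0 hf le_rfl
  obtain ⟨ν, hν, hQν⟩ := exists_measure_of_nonneg (G ∘ₗ LinearMap.inr ℝ _ _)
    fun g hg => hpos 0 g le_rfl hg
  refine ⟨μ, ν, hμ, hν, fun v => ?_⟩
  rw [← hPμ, ← hQν, ← hGF, sub_eq_add_neg, ← map_neg]
  simp only [LinearMap.comp_apply, LinearMap.inl_apply, LinearMap.inr_apply]
  rw [← map_add, Prod.mk_add_mk, add_zero, zero_add]
  rfl

end ContinuousMap

/-! ### Derivative and primitive on test functions -/

namespace PeriodicCurve

namespace TestFun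

section

variable {M : ℝ}

theorem integralLin_derivLin (φ : TestFun M) : integralLin M (derivLin M φ) = 0 := by
  have h := intervalIntegral.integral_eq_sub_of_hasDerivAt (a := 0) (b := M) (f := φ)
    (fun t _ => ((contDiff_infty_iff_deriv.1 φ.contDiff).1 t).hasDerivAt)
    ((derivLin M φ).intervalIntegrable 0 M)
  have h0 := φ.periodic 0
  rw [zero_add] at h0
  rw [h0, sub_self] at h
  exact h

theorem meanFree_of_integralLin_eq_zero {φ : TestFun M} (h : integralLin M φ = 0) :
    meanFree M φ = φ := by
  rw [meanFree_apply, h, mul_zero, zero_smul, sub_zero]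

theorem derivLin_meanFree (φ : TestFun M) : derivLin M (meanFree M φ) = derivLin M φ := by
  rw [meanFree_apply, map_sub, map_smul, derivLin_one, smul_zero, sub_zero]

theorem eq_smul_one_of_derivLin_eq_zero {φ : TestFun M} (h : derivLin M φ = 0) :
    φ = φ 0 • one M := by
  ext t
  rw [smul_apply, one_apply, mul_one]
  exact is_const_of_deriv_eq_zero (contDiff_infty_iff_deriv.1 φ.contDiff).1
    (fun s => DFunLike.congr_fun h s) t 0

end

/-- The inclusion of `S(T_M)` into the continuous functions on the circle. -/
def toContinuousMap (M : ℝ) [Fact (0 < M)] : TestFun M →ₗ[ℝ] C(AddCircle M, ℝ) where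
  toFun φ := ⟨φ.periodic.lift, φ.continuous_lift⟩
  map_add' φ ψ := by
    ext x
    obtain ⟨t, rfl⟩ := QuotientAddGroup.mk_surjective x
    rfl
  map_smul' c φ := by
    ext x
    obtain ⟨t, rfl⟩ := QuotientAddGroup.mk_surjective x
    rfl

variable {M : ℝ} [hM : Fact (0 < M)]

theorem toContinuousMap_injective : Function.Injective (toContinuousMap M) := fun _ _ h =>
  TestFun.ext fun t => DFunLike.congr_fun h (t : AddCircle M)

theorem supSeminorm_le_norm_toContinuousMap (φ : TestFun M) :
    supSeminorm M φ ≤ ‖toContinuousMap M φ‖ :=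
  ciSup_le fun t => (toContinuousMap M φ).norm_coe_le_norm t

/-- The difference is a constant `c`, and its integral `c * M` vanishes with `M ≠ 0`. This is the
uniqueness behind the identities for `primitiveLin` below. -/
theorem eq_of_derivLin_eq {φ ψ : TestFun M} (h : derivLin M φ = derivLin M ψ)
    (h' : integralLin M φ = integralLin M ψ) : φ = ψ := by
  have h1 := eq_smul_one_of_derivLin_eq_zero (φ := φ - ψ) (by rw [map_sub, h, sub_self])
  have h2 : integralLin M (φ - ψ) = 0 := by rw [map_sub, h', sub_self]
  rw [h1, map_smul, integralLin_one, smul_eq_mul] at h2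
  rw [(mul_eq_zero.1 h2).resolve_right hM.out.ne', zero_smul] at h1
  exact sub_eq_zero.1 h1

theorem primitiveLin_derivLin (φ : TestFun M) :
    primitiveLin M (derivLin M φ) = meanFree M φ := by
  refine eq_of_derivLin_eq ?_ ?_
  · rw [derivLin_primitiveLin, derivLin_meanFree,
      meanFree_of_integralLin_eq_zero (integralLin_derivLin φ)]
  · rw [integralLin_primitiveLin, integralLin_meanFree]

theorem primitiveLin_one : primitiveLin M (one M) = 0 := by
  refine eq_of_derivLin_eq ?_ ?_
  · rw [derivLin_primitiveLin, meanFree_apply, integralLin_one, inv_mul_cancel₀ hM.out.ne',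
      one_smul, sub_self, map_zero]
  · rw [integralLin_primitiveLin, map_zero]

end TestFun

variable (M : ℝ) [hM : Fact (0 < M)]

/-! ### Distributions of finite TV norm are measures -/

/-- Rescaling `φ` to the unit sphere reduces this to the definition of the supremum; a test function
of zero uniform norm is zero and is treated apart. -/
theorem le_toReal_tvNorm_mul_supSeminorm {w : Distr M} (hw : tvNorm M w < ⊤) (φ : TestFun M) :
    w φ ≤ (tvNorm M w).toReal * TestFun.supSeminorm M φ := by
  by_cases h0 : TestFun.supSeminorm M φ = 0
  · have : φ = 0 := TestFun.ext fun t => by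
      have := φ.abs_le_supSeminorm t
      rw [h0] at this
      simpa using this
    simp [this]
  · have hpos : 0 < TestFun.supSeminorm M φ := lt_of_le_of_ne (apply_nonneg _ _) (Ne.symm h0)
    have h1 : TestFun.supSeminorm M ((TestFun.supSeminorm M φ)⁻¹ • φ) = 1 := by
      rw [map_smul_eq_mul, Real.norm_eq_abs, abs_of_pos (inv_pos.2 hpos), inv_mul_cancel₀ h0]
    have h3 := le_toReal_tvNorm M hw h1
    rwa [map_smul, smul_eq_mul, inv_mul_le_iff₀ hpos, mul_comm] at h3

theorem toReal_tvNorm_nonneg (w : Distr M) : 0 ≤ (tvNorm M w).toReal :=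
  EReal.toReal_nonneg (supOn_nonneg (B := pairingB M) (unitSphere_nonempty M)
    (unitSphere_neg M) w)

/-- A periodic distribution of finite TV norm is a Radon measure. -/
theorem isRadon_of_tvNorm_lt_top {w : Distr M} (hw : tvNorm M w < ⊤) : IsRadon M w :=
  ContinuousMap.exists_measure_sub_measure_of_bound (TestFun.toContinuousMap M)
    TestFun.toContinuousMap_injective w.toLinearMap (toReal_tvNorm_nonneg M w) fun φ =>
      (le_toReal_tvNorm_mul_supSeminorm M hw φ).trans
        (mul_le_mul_of_nonneg_left φ.supSeminorm_le_norm_toContinuousMap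
          (toReal_tvNorm_nonneg M w))

/-! ### `L` and its pseudoinverse -/

/-- The projection `w ↦ w - M⁻¹ ⟨w, 1⟩` onto the distributions of zero mean. -/
def distrMeanFree : Distr M →ₗ[ℝ] Distr M :=
  LinearMap.id - (M⁻¹ • pairing M (TestFun.one M)).smulRight (TestFun.integralCLM M)

theorem distrMeanFree_eq (w : Distr M) :
    distrMeanFree M w = w - constDistr M (w (TestFun.one M) / M) := by
  rw [constDistr, div_eq_inv_mul]
  rfl

/-- The mean-free projection is self-adjoint, so identities between operators on distributions can
be checked on test functions. -/
theorem distrMeanFree_apply (w : Distr M) (φ : TestFun M) :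
    distrMeanFree M w φ = w (TestFun.meanFree M φ) := by
  rw [distrMeanFree_eq, TestFun.meanFree_apply, map_sub, map_smul]
  change w φ - w (TestFun.one M) / M * TestFun.integralLin M φ = w φ - _ * w (TestFun.one M)
  ring

theorem distrDeriv_apply (w : Distr M) (φ : TestFun M) :
    distrDeriv M w φ = -w (TestFun.derivLin M φ) := rfl

theorem distrPrimitive_apply (w : Distr M) (φ : TestFun M) :
    distrPrimitive M w φ = -w (TestFun.primitiveLin M φ) := rfl

/-- By duality the order of composition is reversed and the two minus signs cancel. -/
theorem distrDeriv_mul_distrPrimitive :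
    distrDeriv M * distrPrimitive M = distrMeanFree M := by
  ext w φ
  rw [Module.End.mul_apply, distrDeriv_apply, distrPrimitive_apply, neg_neg,
    TestFun.primitiveLin_derivLin, distrMeanFree_apply]

theorem distrPrimitive_mul_distrDeriv :
    distrPrimitive M * distrDeriv M = distrMeanFree M := by
  ext w φ
  rw [Module.End.mul_apply, distrPrimitive_apply, distrDeriv_apply, neg_neg,
    TestFun.derivLin_primitiveLin, distrMeanFree_apply]

theorem isIdempotentElem_distrMeanFree : IsIdempotentElem (distrMeanFree M) := by
  ext w φ
  rw [Module.End.mul_apply, distrMeanFree_apply, distrMeanFree_apply, distrMeanFree_apply,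
    TestFun.meanFree_of_integralLin_eq_zero (TestFun.integralLin_meanFree φ)]

theorem commute_distrDeriv_distrPrimitive : Commute (distrDeriv M) (distrPrimitive M) :=
  (distrDeriv_mul_distrPrimitive M).trans (distrPrimitive_mul_distrDeriv M).symm

/-- Commutation gathers the powers into `(D D†)^(α+1)`, a positive power of an idempotent. -/
theorem opL_mul_opLDagger (α : ℕ) : opL M α * opLDagger M α = distrMeanFree M := by
  rw [opL, opLDagger, ← (commute_distrDeriv_distrPrimitive M).mul_pow,
    distrDeriv_mul_distrPrimitive, (isIdempotentElem_distrMeanFree M).pow_succ_eq]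

theorem opLDagger_mul_opL (α : ℕ) : opLDagger M α * opL M α = distrMeanFree M := by
  rw [opL, opLDagger, ← (commute_distrDeriv_distrPrimitive M).symm.mul_pow,
    distrPrimitive_mul_distrDeriv, (isIdempotentElem_distrMeanFree M).pow_succ_eq]

theorem opL_apply_one (α : ℕ) (w : Distr M) : opL M α w (TestFun.one M) = 0 := by
  -- `pow_succ'` exposes the outermost `D`, which transposes onto the constant test function.
  rw [opL, pow_succ', Module.End.mul_apply, distrDeriv_apply, TestFun.derivLin_one, map_zero,
    neg_zero]

theorem opLDagger_apply_one (α : ℕ) (w : Distr M) : opLDagger M α w (TestFun.one M) = 0 := by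
  rw [opLDagger, pow_succ', Module.End.mul_apply, distrPrimitive_apply, TestFun.primitiveLin_one,
    map_zero, neg_zero]

theorem constDistr_apply_one (a : ℝ) : constDistr M a (TestFun.one M) = a * M :=
  congrArg (a * ·) TestFun.integralLin_one

theorem opL_constDistr (α : ℕ) (a : ℝ) : opL M α (constDistr M a) = 0 := by
  have h : distrDeriv M (constDistr M a) = 0 := by
    ext φ
    rw [distrDeriv_apply]
    change -(a * TestFun.integralLin M (TestFun.derivLin M φ)) = 0
    rw [TestFun.integralLin_derivLin, mul_zero, neg_zero]
  -- Here the innermost `D` is split off instead, since it acts first and already kills the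
  -- constant.
  rw [opL, pow_succ, Module.End.mul_apply, h, map_zero]

theorem opL_opLDagger_add_constDistr (α : ℕ) {w : Distr M} (hw : w (TestFun.one M) = 0) (a : ℝ) :
    opL M α (opLDagger M α w + constDistr M a) = w := by
  rw [map_add, opL_constDistr, add_zero, ← Module.End.mul_apply, opL_mul_opLDagger,
    distrMeanFree_eq, hw, zero_div, constDistr, zero_smul, sub_zero]

theorem opLDagger_opL_add_constDistr (α : ℕ) (f : Distr M) :
    opLDagger M α (opL M α f) + constDistr M (f (TestFun.one M) / M) = f := by
  rw [← Module.End.mul_apply, opLDagger_mul_opL, distrMeanFree_eq, sub_add_cancel]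

/-! ### Comparison of the TV norm and the RI-TV norm -/

theorem mixedNorm_fst_zero (φ : TestFun M) : mixedNorm M (φ, 0) = TestFun.supSeminorm M φ := by
  simp [mixedNorm, EuclideanSpace.norm_eq, TestFun.supSeminorm_apply, Real.sqrt_sq_eq_abs]

theorem mixedNorm_zero_snd (φ : TestFun M) : mixedNorm M (0, φ) = TestFun.supSeminorm M φ := by
  simp [mixedNorm, EuclideanSpace.norm_eq, TestFun.supSeminorm_apply, Real.sqrt_sq_eq_abs]

theorem norm_le_mixedNorm (φ : TestFun M × TestFun M) (t : ℝ) :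
    ‖!₂[φ.1 t, φ.2 t]‖ ≤ mixedNorm M φ := by
  refine le_ciSup (f := fun t : ℝ => ‖!₂[φ.1 t, φ.2 t]‖) ?_ t
  -- A real supremum is informative only over a bounded set; `‖(a, b)‖₂ ≤ |a| + |b|` supplies a
  -- crude bound.
  refine ⟨TestFun.supSeminorm M φ.1 + TestFun.supSeminorm M φ.2, ?_⟩
  rintro _ ⟨t, rfl⟩
  have h1 := φ.1.abs_le_supSeminorm t
  have h2 := φ.2.abs_le_supSeminorm t
  refine le_trans ?_ (add_le_add h1 h2)
  simp only [EuclideanSpace.norm_eq, Fin.sum_univ_two, Real.norm_eq_abs]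
  refine Real.sqrt_le_iff.2 ⟨by positivity, ?_⟩
  simp only [Matrix.cons_val_zero, Matrix.cons_val_one]
  nlinarith [abs_nonneg (φ.1 t), abs_nonneg (φ.2 t)]

theorem supSeminorm_fst_le_mixedNorm (φ : TestFun M × TestFun M) :
    TestFun.supSeminorm M φ.1 ≤ mixedNorm M φ :=
  ciSup_le fun t => (PiLp.norm_apply_le !₂[φ.1 t, φ.2 t] 0).trans (norm_le_mixedNorm M φ t)

theorem supSeminorm_snd_le_mixedNorm (φ : TestFun M × TestFun M) :
    TestFun.supSeminorm M φ.2 ≤ mixedNorm M φ :=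
  ciSup_le fun t => (PiLp.norm_apply_le !₂[φ.1 t, φ.2 t] 1).trans (norm_le_mixedNorm M φ t)

/-- Test pairs `(φ, 0)` have mixed norm equal to the uniform norm of `φ`, so they compete in the
supremum defining `R`. -/
theorem tvNorm_fst_le_ritvNorm (w : Distr M × Distr M) : tvNorm M w.1 ≤ ritvNorm M w :=
  iSup₂_le fun φ hφ => le_iSup₂_of_le (φ, 0) ((mixedNorm_fst_zero M φ).trans hφ) (by simp)

theorem tvNorm_snd_le_ritvNorm (w : Distr M × Distr M) : tvNorm M w.2 ≤ ritvNorm M w :=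
  iSup₂_le fun φ hφ => le_iSup₂_of_le (0, φ) ((mixedNorm_zero_snd M φ).trans hφ) (by simp)

/-- Each component of a pair of mixed norm one has uniform norm at most one, possibly less, hence
the homogeneous bound on `w φ` is needed. -/
theorem pairing_le_of_mixedNorm_eq_one {w : Distr M × Distr M} (h₁ : tvNorm M w.1 < ⊤)
    (h₂ : tvNorm M w.2 < ⊤) {φ : TestFun M × TestFun M} (hφ : mixedNorm M φ = 1) :
    w.1 φ.1 + w.2 φ.2 ≤ (tvNorm M w.1).toReal + (tvNorm M w.2).toReal := by
  have k₁ := mul_le_mul_of_nonneg_left ((supSeminorm_fst_le_mixedNorm M φ).trans_eq hφ)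
    (toReal_tvNorm_nonneg M w.1)
  have k₂ := mul_le_mul_of_nonneg_left ((supSeminorm_snd_le_mixedNorm M φ).trans_eq hφ)
    (toReal_tvNorm_nonneg M w.2)
  have l₁ := le_toReal_tvNorm_mul_supSeminorm M h₁ φ.1
  have l₂ := le_toReal_tvNorm_mul_supSeminorm M h₂ φ.2
  linarith

theorem ritvNorm_le {w : Distr M × Distr M} (h₁ : tvNorm M w.1 < ⊤) (h₂ : tvNorm M w.2 < ⊤) :
    ritvNorm M w ≤ (((tvNorm M w.1).toReal + (tvNorm M w.2).toReal : ℝ) : EReal) :=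
  iSup₂_le fun _ hφ => EReal.coe_le_coe_iff.2 (pairing_le_of_mixedNorm_eq_one M h₁ h₂ hφ)

theorem ritvNorm_lt_top_iff {w : Distr M × Distr M} :
    ritvNorm M w < ⊤ ↔ tvNorm M w.1 < ⊤ ∧ tvNorm M w.2 < ⊤ :=
  ⟨fun h => ⟨(tvNorm_fst_le_ritvNorm M w).trans_lt h, (tvNorm_snd_le_ritvNorm M w).trans_lt h⟩,
    fun h => (ritvNorm_le M h.1 h.2).trans_lt (EReal.coe_lt_top _)⟩

theorem toReal_ritvNorm_le {w : Distr M × Distr M} (h₁ : tvNorm M w.1 < ⊤)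
    (h₂ : tvNorm M w.2 < ⊤) :
    (ritvNorm M w).toReal ≤ (tvNorm M w.1).toReal + (tvNorm M w.2).toReal :=
  toReal_supOn_le (B := pairingB₂ M) (mixedSphere_nonempty M) (mixedSphere_neg M)
    fun _ hφ => pairing_le_of_mixedNorm_eq_one M h₁ h₂ hφ

/-- `EReal.toReal` sends both infinities to `0`, so comparing real parts requires excluding `⊥` for
the smaller side and `⊤` for the larger. -/
theorem bot_lt_tvNorm (w : Distr M) : ⊥ < tvNorm M w :=
  lt_of_lt_of_le EReal.bot_lt_zero
    (supOn_nonneg (B := pairingB M) (unitSphere_nonempty M) (unitSphere_neg M) w)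

theorem toReal_tvNorm_fst_le {w : Distr M × Distr M} (h : ritvNorm M w < ⊤) :
    (tvNorm M w.1).toReal ≤ (ritvNorm M w).toReal :=
  EReal.toReal_le_toReal (tvNorm_fst_le_ritvNorm M w) (bot_lt_tvNorm M _).ne' h.ne

theorem toReal_tvNorm_snd_le {w : Distr M × Distr M} (h : ritvNorm M w < ⊤) :
    (tvNorm M w.2).toReal ≤ (ritvNorm M w).toReal :=
  EReal.toReal_le_toReal (tvNorm_snd_le_ritvNorm M w) (bot_lt_tvNorm M _).ne' h.ne

theorem searchSpace_eq_prod (α : ℕ) :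
    searchSpace M α = (nativeSpace M α).prod (nativeSpace M α) :=
  Submodule.ext fun _ => ritvNorm_lt_top_iff M

/-! ### The isomorphisms -/

/-- The identity of `X_L = M_L × M_L`, as a linear equivalence. -/
def searchSpaceLinearEquiv (α : ℕ) :
    SearchSpace M α ≃ₗ[ℝ] NativeSpace M α × NativeSpace M α where
  toFun r := (⟨r.1.1, ((ritvNorm_lt_top_iff M).1 r.2).1⟩,
    ⟨r.1.2, ((ritvNorm_lt_top_iff M).1 r.2).2⟩)
  map_add' _ _ := rfl
  map_smul' _ _ := rfl
  invFun p := ⟨(p.1.1, p.2.1), (ritvNorm_lt_top_iff M).2 ⟨p.1.2, p.2.2⟩⟩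
  left_inv _ := rfl
  right_inv _ := rfl

/-- The identity of `X_L = M_L × M_L`, as a linear homeomorphism. -/
def searchSpaceEquiv (α : ℕ) : SearchSpace M α ≃L[ℝ] NativeSpace M α × NativeSpace M α :=
  -- The product carries the maximum norm: each component norm is at most `‖r‖`, while conversely
  -- `‖r‖` is at most the sum of the two component norms, hence twice their maximum.
  (searchSpaceLinearEquiv M α).toContinuousLinearEquivOfBounds 1 2
    (fun r => by
      have h₁ := toReal_tvNorm_fst_le M r.2
      have h₂ := toReal_tvNorm_snd_le M r.2
      have k := SearchSpace.norm_def M α r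
      rw [Prod.norm_def] at k
      have k₁ := le_max_left ‖(SearchSpace.toDistr M α r).1 (TestFun.one M)‖
        ‖(SearchSpace.toDistr M α r).2 (TestFun.one M)‖
      have k₂ := le_max_right ‖(SearchSpace.toDistr M α r).1 (TestFun.one M)‖
        ‖(SearchSpace.toDistr M α r).2 (TestFun.one M)‖
      rw [one_mul, k]
      exact max_le (add_le_add h₁ k₁) (add_le_add h₂ k₂))
    (fun p => by
      have h := toReal_ritvNorm_le M (w := (opL M α p.1.1, opL M α p.2.1)) p.1.2 p.2.2
      have k := SearchSpace.norm_def M α ((searchSpaceLinearEquiv M α).symm p)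
      have l : ‖(p.1.1 (TestFun.one M), p.2.1 (TestFun.one M))‖ ≤
          |p.1.1 (TestFun.one M)| + |p.2.1 (TestFun.one M)| :=
        max_le_add_of_nonneg (abs_nonneg _) (abs_nonneg _)
      have m₁ := (NativeSpace.norm_def M α p.1).symm.trans_le (norm_fst_le p)
      have m₂ := (NativeSpace.norm_def M α p.2).symm.trans_le (norm_snd_le p)
      rw [k]
      refine (add_le_add h l).trans ?_
      rw [two_mul]
      refine le_trans (le_of_eq ?_) (add_le_add m₁ m₂)
      exact add_add_add_comm _ _ _ _)

/-- `f ↦ (L f, ⟨f, 1⟩)`, with inverse `(w, a) ↦ L† w + a / M`, as a linear equivalence. -/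
def nativeSpaceLinearEquiv (α : ℕ) : NativeSpace M α ≃ₗ[ℝ] MeanZeroMeasure M × ℝ where
  -- The representation theorem enters here: it makes `L f` an element of `M₀`, not merely a
  -- distribution of finite TV norm.
  toFun f := (⟨opL M α f.1, isRadon_of_tvNorm_lt_top M f.2, opL_apply_one M α f.1⟩,
    f.1 (TestFun.one M))
  map_add' f g := Prod.ext (Subtype.ext (map_add (opL M α) f.1 g.1)) rfl
  map_smul' c f := Prod.ext (Subtype.ext (map_smul (opL M α) c f.1)) rfl
  invFun p := ⟨opLDagger M α p.1.1 + constDistr M (p.2 / M), by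
    change tvNorm M (opL M α _) < ⊤
    rw [opL_opLDagger_add_constDistr M α p.1.2.2]
    exact radonMeasures₀_le_finiteTV M p.1.2⟩
  left_inv f := Subtype.ext (opLDagger_opL_add_constDistr M α f.1)
  right_inv p := by
    refine Prod.ext (Subtype.ext (opL_opLDagger_add_constDistr M α p.1.2.2 _)) ?_
    change opLDagger M α p.1.1 (TestFun.one M) + constDistr M (p.2 / M) (TestFun.one M) = p.2
    rw [opLDagger_apply_one, constDistr_apply_one, zero_add, div_mul_cancel₀ _ hM.out.ne']

/-- `f ↦ (L f, ⟨f, 1⟩)` as a linear homeomorphism of `M_L(T_M)` onto `M₀(T_M) × ℝ`. -/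
def nativeSpaceEquiv (α : ℕ) : NativeSpace M α ≃L[ℝ] MeanZeroMeasure M × ℝ := by
  -- The map would be an isometry for the sum norm on the target; the constants `1` and `2` below
  -- only compare the sum with the maximum.
  have key : ∀ f : NativeSpace M α, ‖f‖ = ‖(nativeSpaceLinearEquiv M α f).1‖ +
      ‖(nativeSpaceLinearEquiv M α f).2‖ := fun f => NativeSpace.norm_def M α f
  refine (nativeSpaceLinearEquiv M α).toContinuousLinearEquivOfBounds 1 2
    (fun f => ?_) (fun p => ?_)
  · rw [one_mul, key]
    exact max_le_add_of_nonneg (norm_nonneg _) (norm_nonneg _)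
  · rw [key, LinearEquiv.apply_symm_apply, two_mul]
    exact add_le_add (norm_fst_le p) (norm_snd_le p)

/-- The isomorphism `T_L`. -/
def searchSpaceIso (α : ℕ) :
    SearchSpace M α ≃L[ℝ] (MeanZeroMeasure M × MeanZeroMeasure M) × (ℝ × ℝ) :=
  ((searchSpaceEquiv M α).trans ((nativeSpaceEquiv M α).prodCongr (nativeSpaceEquiv M α))).trans
    -- This regroups `(M₀ × ℝ) × (M₀ × ℝ)` as `(M₀ × M₀) × (ℝ × ℝ)`.
    (ContinuousLinearEquiv.prodProdProdComm ℝ _ _ _ _)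

end PeriodicCurve

end

theorem mainTheorem5 (M : ℝ) [Fact (0 < M)] (α : ℕ) (hα : 1 ≤ α) :
    -- `X_L = M_L × M_L`, as spaces of distributions and topologically
    searchSpace M α =
        (nativeSpace M α).prod (nativeSpace M α) ∧
    (∃ e : SearchSpace M α ≃L[ℝ]
          NativeSpace M α × NativeSpace M α,
      ∀ r : SearchSpace M α,
        (NativeSpace.toDistr M α (e r).1,
            NativeSpace.toDistr M α (e r).2) =
          SearchSpace.toDistr M α r) ∧
    -- the isomorphism `T_L` and its inverse
    ∃ T : SearchSpace M α ≃L[ℝ]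
          (MeanZeroMeasure M × MeanZeroMeasure M) × (ℝ × ℝ),
      (∀ r : SearchSpace M α,
        MeanZeroMeasure.toDistr M (T r).1.1 =
            opL M α (SearchSpace.toDistr M α r).1 ∧
        MeanZeroMeasure.toDistr M (T r).1.2 =
            opL M α (SearchSpace.toDistr M α r).2 ∧
        (T r).2.1 =
            (SearchSpace.toDistr M α r).1 (TestFun.one M) ∧
        (T r).2.2 =
            (SearchSpace.toDistr M α r).2 (TestFun.one M)) ∧
      ∀ (w₁ w₂ : MeanZeroMeasure M) (a₁ a₂ : ℝ),
        SearchSpace.toDistr M α (T.symm ((w₁, w₂), (a₁, a₂))) =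
          (opLDagger M α (MeanZeroMeasure.toDistr M w₁) +
              constDistr M (a₁ / M),
            opLDagger M α (MeanZeroMeasure.toDistr M w₂) +
              constDistr M (a₂ / M)) :=
  -- The formulas for both equivalences and for the inverse hold by `rfl`, because the underlying
  -- linear maps were defined by these very expressions.
  ⟨searchSpace_eq_prod M α, ⟨searchSpaceEquiv M α, fun _ => rfl⟩, searchSpaceIso M α,
    fun _ => ⟨rfl, rfl, rfl, rfl⟩, fun _ _ _ _ => rfl⟩
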